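/- Let $P$ be a simple orthogonal polygon, i.e. a closed plane region bounded by a non-self-intersecting closed broken line all of whose sides are parallel to the coordinate axes. Suppose that $P$ is generic, i.e. the $y$-coordinates of its horizontal sides are pairwise distinct, and that all its vertices have rational coordinates. Let $c>0$ be a real number. A tiling is a finite covering by nondegenerate closed rectangles with sides parallel to the coordinate axes and with pairwise disjoint interiors, whose union is exactly the tiled figure; the ratio of a rectangle is the length of its horizontal side divided by the length of its vertical side. Then $P$ can be tiled by rectangles of ratios $c$ and $1/c$ (each rectangle having one of these two ratios) if and only if some square with sides parallel to the coordinate axes can be tiled by rectangles of ratios $c$ and $1/c$. Moreover, if $P$ can be so tiled, then $c$ is algebraic over $\mathbb{Q}$ and every algebraic conjugate of $c$ (complex root of its minimal polynomial over $\mathbb{Q}$) has positive real part. -/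

import Mathlib

/-- A nondegenerate closed rectangle in the plane with sides parallel to the coordinate axes. -/
structure AxisRect where
  left : ℝ
  right : ℝ
  bottom : ℝ
  top : ℝ
  left_lt_right : left < right
  bottom_lt_top : bottom < top

namespace AxisRect

/-- The closed set of points of the rectangle. -/
def toSet (R : AxisRect) : Set (ℝ × ℝ) :=
  Set.Icc R.left R.right ×ˢ Set.Icc R.bottom R.top

/-- The ratio: length of the horizontal side divided by length of the vertical side. -/
noncomputable def ratio (R : AxisRect) : ℝ :=
  (R.right - R.left) / (R.top - R.bottom)

/-- The rectangle is a square. -/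
def IsSquare (R : AxisRect) : Prop :=
  R.right - R.left = R.top - R.bottom

end AxisRect

/-- The finite family of rectangles `R` tiles `P`: the rectangles cover exactly `P`, and
distinct members of the family have disjoint interiors. -/
structure IsTiling (P : Set (ℝ × ℝ)) {m : ℕ} (R : Fin m → AxisRect) : Prop where
  cover : ⋃ i, (R i).toSet = P
  nonoverlapping :
    Pairwise fun i j => Disjoint (interior (R i).toSet) (interior (R j).toSet)

/-- `P` can be tiled by finitely many rectangles whose ratios belong to the set `S`. -/
def CanBeTiledByRatios (P : Set (ℝ × ℝ)) (S : Set ℝ) : Prop :=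
  ∃ (m : ℕ) (R : Fin m → AxisRect), IsTiling P R ∧ ∀ i, (R i).ratio ∈ S

namespace Polygon

variable {n : ℕ}

/-- The closed broken line with vertices `v` has no self-intersections: its edges are
nondegenerate, and two distinct edges have no common point except that consecutive edges share
their common vertex. -/
structure IsSimpleClosed (v : Polygon (ℝ × ℝ) n) : Prop where
  three_le : 3 ≤ n
  nondegenerate : v.HasNondegenerateEdges
  inter_edges : ∀ i j, i ≠ j → ∀ z ∈ v.edgeSet ℝ i ∩ v.edgeSet ℝ j,
    (j = finRotate n i ∧ z = v j) ∨ (i = finRotate n j ∧ z = v i)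

/-- The side from the `i`-th vertex to the next one is horizontal. -/
def IsHorizontalSide (v : Polygon (ℝ × ℝ) n) (i : Fin n) : Prop :=
  (v i).2 = (v (finRotate n i)).2

/-- The side from the `i`-th vertex to the next one is vertical. -/
def IsVerticalSide (v : Polygon (ℝ × ℝ) n) (i : Fin n) : Prop :=
  (v i).1 = (v (finRotate n i)).1

/-- All sides are parallel to the coordinate axes, and consecutive sides are perpendicular (so
that each side is a full side of the polygon, and each vertex is a true corner). -/
def IsOrthogonal (v : Polygon (ℝ × ℝ) n) : Prop :=
  ∀ i, (v.IsHorizontalSide i ∧ v.IsVerticalSide (finRotate n i)) ∨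
    (v.IsVerticalSide i ∧ v.IsHorizontalSide (finRotate n i))

/-- The `y`-coordinates of the horizontal sides are pairwise distinct. -/
def IsGeneric (v : Polygon (ℝ × ℝ) n) : Prop :=
  ∀ i j, v.IsHorizontalSide i → v.IsHorizontalSide j → i ≠ j → (v i).2 ≠ (v j).2

/-- All vertices have rational coordinates. -/
def HasRationalVertices (v : Polygon (ℝ × ℝ) n) : Prop :=
  ∀ i, ∃ p q : ℚ, v i = ((p : ℝ), (q : ℝ))

/-- `P` is the closed plane region bounded by the simple closed broken line with vertices `v`:
it is compact, its topological boundary is the broken line, and it has no lower-dimensional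
parts, i.e. it is the closure of its interior. (By the Jordan curve theorem, such a `P` is
exactly the union of the broken line and the bounded component of its complement.) -/
structure IsSimpleRegion (v : Polygon (ℝ × ℝ) n) (P : Set (ℝ × ℝ)) : Prop where
  isSimpleClosed : v.IsSimpleClosed
  isCompact : IsCompact P
  frontier_eq : frontier P = v.boundary ℝ
  closure_interior_eq : closure (interior P) = P

end Polygon

/-! The polygon matters only because, having rational vertices, it splits into congruent squares of
side 1/N (`Polygon.exists_square_tiling`). A tiling of one square therefore rescales to a tiling of
P. The converse passes through the conjugates of c.

Necessity. For additive f and g, the sum of f(width)·g(height) over the tiles is the same for all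
tilings of a figure (`IsTiling.sum_biadditive_eq`). Choose f with f(1) = 1 and f(cx) = w f(x), where
w is a conjugate of c, or -c if c is transcendental, and let g be the complex conjugate of f. Each
tile of ratio c or 1/c then contributes to the real part Re w times a nonnegative number, while the
squares of side 1/N give a positive total. Hence Re w > 0, which also excludes transcendence.

Sufficiency. Tileable ratios are closed under addition, inversion and multiplication by positive
rationals. If all roots of the minimal polynomial p lie in the right half-plane, then |p(z)| <
|p(-z)| there, so the quotient of the even and odd parts of p(-X) has positive real part there. Up
to inversion such a quotient is a continued fraction d₁z + 1/(d₂z + ...) with positive rational dᵢ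
(`HasPositiveRatio.eval_induction`). At z = c, where p vanishes, its value is 1, so squares are
tileable. -/

open Set Filter Topology Polynomial Bornology

/-! ### Additive rectangle functions do not depend on the tiling -/

/-- Weights for which an additive function is recovered by summation over the points of `s` in a
half-open interval with endpoints in `s`. -/
theorem exists_increment_weights (f : ℝ →+ ℂ) (s : Finset ℝ) :
    ∃ δ : ℝ → ℂ, ∀ a ∈ s, ∀ b ∈ s, a ≤ b →
      ∑ x ∈ s, (if x ∈ Ico a b then δ x else 0) = f (b - a) := by
  induction s using Finset.induction_on_max with
  | empty => exact ⟨0, by simp⟩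
  | insert m s hm ih =>
    obtain ⟨δ, hδ⟩ := ih
    have hms : m ∉ s := fun h => lt_irrefl _ (hm m h)
    rcases s.eq_empty_or_nonempty with rfl | hs
    · refine ⟨0, ?_⟩
      simp
    · set p := s.max' hs with hp
      have hps : p ∈ s := s.max'_mem hs
      have hpm : p < m := hm p hps
      -- The previous maximum p receives the increment up to m. Intervals with right endpoint in `s`
      -- exclude p, so the earlier sums do not change.
      refine ⟨Function.update δ p (f (m - p)), ?_⟩
      have key : ∀ a ∈ s, ∀ b ∈ s, a ≤ b →
          ∑ x ∈ s, (if x ∈ Ico a b then Function.update δ p (f (m - p)) x else 0)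
            = f (b - a) := by
        intro a ha b hb hab
        rw [← hδ a ha b hb hab]
        refine Finset.sum_congr rfl fun x _ => ?_
        split_ifs with hx
        · rw [Function.update_of_ne]
          exact (hx.2.trans_le (s.le_max' b hb)).ne
        · rfl
      intro a ha b hb hab
      rw [Finset.sum_insert hms]
      rcases Finset.mem_insert.1 ha with rfl | ha'
      · have hba : b = a := by
          rcases Finset.mem_insert.1 hb with rfl | hb
          · rfl
          · exact absurd (hm b hb) (not_lt.2 hab)
        subst hba
        simp
      · rcases Finset.mem_insert.1 hb with rfl | hb
        · rw [if_neg (by simp), zero_add]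
          have hap : a ≤ p := s.le_max' a ha'
          have : ∀ x ∈ s, (if x ∈ Ico a b then Function.update δ p (f (b - p)) x else 0)
              = (if x ∈ Ico a p then Function.update δ p (f (b - p)) x else 0)
                + (if x = p then f (b - p) else 0) := by
            intro x hx
            have hxp : x ≤ p := s.le_max' x hx
            by_cases h : x = p
            · subst h
              simp [hap, hpm]
            · have hlt : x < p := lt_of_le_of_ne hxp h
              simp [h, hlt, hlt.trans hpm]
          rw [Finset.sum_congr rfl this, Finset.sum_add_distrib, key a ha' p hps hap,
            Finset.sum_ite_eq' s p, if_pos hps, ← map_add]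
          congr 1
          ring
        · rw [if_neg (fun h => (h.2.trans (hm b hb)).false), zero_add]
          exact key a ha' b hb hab

namespace AxisRect

/-- The rectangle without its right and top sides. -/
def halfOpen (R : AxisRect) : Set (ℝ × ℝ) :=
  Ico R.left R.right ×ˢ Ico R.bottom R.top

theorem interior_toSet (R : AxisRect) :
    interior R.toSet = Ioo R.left R.right ×ˢ Ioo R.bottom R.top := by
  rw [toSet, interior_prod_eq, interior_Icc, interior_Icc]

/-- A small diagonal shift moves points of the left and bottom sides inwards and points of the right
and top sides out. Boundary points are thus assigned by a rule that makes sense for any figure. -/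
theorem mem_halfOpen_iff_eventually (R : AxisRect) (z : ℝ × ℝ) :
    z ∈ R.halfOpen ↔ ∀ᶠ t : ℝ in 𝓝[>] 0, (z.1 + t, z.2 + t) ∈ interior R.toSet := by
  rw [interior_toSet]
  constructor
  · rintro ⟨⟨h1, h2⟩, h3, h4⟩
    have e1 : ∀ᶠ t : ℝ in 𝓝[>] 0, t < R.right - z.1 :=
      nhdsWithin_le_nhds (Iio_mem_nhds (by linarith))
    have e2 : ∀ᶠ t : ℝ in 𝓝[>] 0, t < R.top - z.2 :=
      nhdsWithin_le_nhds (Iio_mem_nhds (by linarith))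
    filter_upwards [e1, e2, self_mem_nhdsWithin] with t h5 h6 h7
    have h7 : 0 < t := h7
    exact ⟨⟨by simp only; linarith, by simp only; linarith⟩,
      by simp only; linarith, by simp only; linarith⟩
  · intro h
    have hl : Tendsto (fun t : ℝ => z.1 + t) (𝓝[>] 0) (𝓝 z.1) := by
      have : Tendsto (fun t : ℝ => z.1 + t) (𝓝 0) (𝓝 (z.1 + 0)) :=
        (continuous_const.add continuous_id).tendsto 0
      rw [add_zero] at this
      exact this.mono_left nhdsWithin_le_nhds
    have hb : Tendsto (fun t : ℝ => z.2 + t) (𝓝[>] 0) (𝓝 z.2) := by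
      have : Tendsto (fun t : ℝ => z.2 + t) (𝓝 0) (𝓝 (z.2 + 0)) :=
        (continuous_const.add continuous_id).tendsto 0
      rw [add_zero] at this
      exact this.mono_left nhdsWithin_le_nhds
    refine ⟨⟨ge_of_tendsto hl (h.mono fun t ht => ht.1.1.le), ?_⟩,
      ge_of_tendsto hb (h.mono fun t ht => ht.2.1.le), ?_⟩
    · obtain ⟨t, ht, h0⟩ := (h.and self_mem_nhdsWithin).exists
      have h0 : 0 < t := h0
      have := ht.1.2
      simp only at this
      linarith
    · obtain ⟨t, ht, h0⟩ := (h.and self_mem_nhdsWithin).exists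
      have h0 : 0 < t := h0
      have := ht.2.2
      simp only at this
      linarith

theorem mem_halfOpen_iff_frequently (R : AxisRect) (z : ℝ × ℝ) :
    z ∈ R.halfOpen ↔ ∃ᶠ t : ℝ in 𝓝[>] 0, (z.1 + t, z.2 + t) ∈ R.toSet := by
  constructor
  · intro h
    exact (((R.mem_halfOpen_iff_eventually z).1 h).mono fun t ht => interior_subset ht).frequently
  · intro h
    refine ⟨⟨?_, ?_⟩, ?_, ?_⟩
    · by_contra! hlt
      have e : ∀ᶠ t : ℝ in 𝓝[>] 0, t < R.left - z.1 :=
        nhdsWithin_le_nhds (Iio_mem_nhds (by linarith))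
      obtain ⟨t, ht, h1⟩ := (h.and_eventually e).exists
      have := ht.1.1
      simp only at this
      linarith
    · obtain ⟨t, ht, h0⟩ := (h.and_eventually self_mem_nhdsWithin).exists
      have h0 : 0 < t := h0
      have := ht.1.2
      simp only at this
      linarith
    · by_contra! hlt
      have e : ∀ᶠ t : ℝ in 𝓝[>] 0, t < R.bottom - z.2 :=
        nhdsWithin_le_nhds (Iio_mem_nhds (by linarith))
      obtain ⟨t, ht, h1⟩ := (h.and_eventually e).exists
      have := ht.2.1
      simp only at this
      linarith
    · obtain ⟨t, ht, h0⟩ := (h.and_eventually self_mem_nhdsWithin).exists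
      have h0 : 0 < t := h0
      have := ht.2.2
      simp only at this
      linarith

/-- The value on `R` of the finitely additive rectangle function built from `f` and `g`. -/
noncomputable def biadditive (f g : ℝ →+ ℂ) (R : AxisRect) : ℂ :=
  f (R.right - R.left) * g (R.top - R.bottom)

end AxisRect

-- The right-hand side mentions only P. A finite union holds frequently iff one member does. Two
-- half-open tiles sharing z would have overlapping interiors at a slightly shifted point.
open Classical in
theorem IsTiling.sum_halfOpen {P : Set (ℝ × ℝ)} {m : ℕ} {R : Fin m → AxisRect}
    (h : IsTiling P R) (z : ℝ × ℝ) :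
    ∑ i, (if z ∈ (R i).halfOpen then (1 : ℂ) else 0) =
      if ∃ᶠ t : ℝ in 𝓝[>] 0, (z.1 + t, z.2 + t) ∈ P then 1 else 0 := by
  have hiff : (∃ᶠ t : ℝ in 𝓝[>] 0, (z.1 + t, z.2 + t) ∈ P) ↔ ∃ i, z ∈ (R i).halfOpen := by
    rw [← h.cover]
    simp only [AxisRect.mem_halfOpen_iff_frequently, mem_iUnion]
    constructor
    · intro hf
      by_contra! hc
      exact hf ((eventually_all.2 hc).mono fun t ht => by simpa using ht)
    · rintro ⟨i, hi⟩
      exact hi.mono fun t ht => ⟨i, ht⟩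
  split_ifs with hz
  · obtain ⟨i, hi⟩ := hiff.1 hz
    rw [Finset.sum_eq_single i, if_pos hi]
    · intro j _ hji
      rw [if_neg]
      intro hj
      obtain ⟨t, h1, h2⟩ := (((R i).mem_halfOpen_iff_eventually z).1 hi |>.and
        (((R j).mem_halfOpen_iff_eventually z).1 hj)).exists
      exact Set.disjoint_left.1 (h.nonoverlapping hji) h2 h1
    · simp
  · refine Finset.sum_eq_zero fun i _ => if_neg fun hi => hz (hiff.2 ⟨i, hi⟩)

/-- With weights on the grid spanned by the side coordinates of both tilings, each tile's value is a
weighted count of the grid points in its half-open version. Summed over a tiling, the count depends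
only on P. -/
theorem IsTiling.sum_biadditive_eq {P : Set (ℝ × ℝ)} {m k : ℕ} {R : Fin m → AxisRect}
    {S : Fin k → AxisRect} (hR : IsTiling P R) (hS : IsTiling P S) (f g : ℝ →+ ℂ) :
    ∑ i, (R i).biadditive f g = ∑ j, (S j).biadditive f g := by
  classical
  let xs : Finset ℝ := Finset.univ.image (fun i => (R i).left) ∪
    Finset.univ.image (fun i => (R i).right) ∪ (Finset.univ.image (fun i => (S i).left) ∪
    Finset.univ.image (fun i => (S i).right))
  let ys : Finset ℝ := Finset.univ.image (fun i => (R i).bottom) ∪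
    Finset.univ.image (fun i => (R i).top) ∪ (Finset.univ.image (fun i => (S i).bottom) ∪
    Finset.univ.image (fun i => (S i).top))
  obtain ⟨α, hα⟩ := exists_increment_weights f xs
  obtain ⟨β, hβ⟩ := exists_increment_weights g ys
  have single : ∀ T : AxisRect, T.left ∈ xs → T.right ∈ xs → T.bottom ∈ ys → T.top ∈ ys →
      T.biadditive f g = ∑ x ∈ xs, ∑ y ∈ ys,
        (if (x, y) ∈ T.halfOpen then (1 : ℂ) else 0) * (α x * β y) := by
    intro T h1 h2 h3 h4
    rw [AxisRect.biadditive, ← hα _ h1 _ h2 T.left_lt_right.le,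
      ← hβ _ h3 _ h4 T.bottom_lt_top.le, Finset.sum_mul_sum]
    refine Finset.sum_congr rfl fun x _ => Finset.sum_congr rfl fun y _ => ?_
    by_cases hx : x ∈ Ico T.left T.right <;> by_cases hy : y ∈ Ico T.bottom T.top <;>
      simp [AxisRect.halfOpen, -mem_Ico, hx, hy]
  have total : ∀ {l : ℕ} (T : Fin l → AxisRect), IsTiling P T →
      (∀ i, (T i).left ∈ xs ∧ (T i).right ∈ xs ∧ (T i).bottom ∈ ys ∧ (T i).top ∈ ys) →
      ∑ i, (T i).biadditive f g = ∑ x ∈ xs, ∑ y ∈ ys,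
        (if ∃ᶠ t : ℝ in 𝓝[>] 0, (x + t, y + t) ∈ P then (1 : ℂ) else 0) * (α x * β y) := by
    intro l T hT hmem
    rw [Finset.sum_congr rfl fun i _ => single (T i) (hmem i).1 (hmem i).2.1 (hmem i).2.2.1
      (hmem i).2.2.2, Finset.sum_comm]
    refine Finset.sum_congr rfl fun x _ => ?_
    rw [Finset.sum_comm]
    refine Finset.sum_congr rfl fun y _ => ?_
    rw [← Finset.sum_mul, hT.sum_halfOpen (x, y)]
  rw [total R hR, total S hS]
  · intro i
    simp [xs, ys]
  · intro i
    simp [xs, ys]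

/-! ### Gluing and rescaling tilings; closure properties of tileable ratios -/

theorem CanBeTiledByRatios.of_finite {P : Set (ℝ × ℝ)} {S : Set ℝ} {ι : Type} [Finite ι]
    (R : ι → AxisRect) (cover : ⋃ i, (R i).toSet = P)
    (nonoverlapping : Pairwise fun i j => Disjoint (interior (R i).toSet) (interior (R j).toSet))
    (hS : ∀ i, (R i).ratio ∈ S) : CanBeTiledByRatios P S := by
  obtain ⟨m, ⟨e⟩⟩ := Finite.exists_equiv_fin ι
  refine ⟨m, fun i => R (e.symm i), ⟨?_, ?_⟩, fun i => hS _⟩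
  · rw [← cover]
    exact e.symm.surjective.iUnion_comp fun i => (R i).toSet
  · intro i j hij
    exact nonoverlapping (e.symm.injective.ne hij)

theorem CanBeTiledByRatios.of_subtilings {P : Set (ℝ × ℝ)} {S : Set ℝ} {ι : Type} [Finite ι]
    (R : ι → AxisRect) (cover : ⋃ i, (R i).toSet = P)
    (nonoverlapping : Pairwise fun i j => Disjoint (interior (R i).toSet) (interior (R j).toSet))
    (hR : ∀ i, CanBeTiledByRatios (R i).toSet S) : CanBeTiledByRatios P S := by
  choose m T hT hS using hR
  refine CanBeTiledByRatios.of_finite (ι := Σ i, Fin (m i)) (fun p => T p.1 p.2) ?_ ?_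
    fun p => hS _ _
  · rw [← cover, iUnion_sigma]
    exact iUnion_congr fun i => (hT i).cover
  · rintro ⟨i, a⟩ ⟨j, b⟩ hij
    by_cases h : i = j
    · subst h
      exact (hT i).nonoverlapping fun hab => hij (congrArg (Sigma.mk i) hab)
    · have hsub : ∀ i a, (T i a).toSet ⊆ (R i).toSet := fun i a => by
        rw [← (hT i).cover]
        exact subset_iUnion (fun a => (T i a).toSet) a
      exact (nonoverlapping h).mono (interior_mono (hsub i a)) (interior_mono (hsub j b))

theorem CanBeTiledByRatios.self {S : Set ℝ} (R : AxisRect) (h : R.ratio ∈ S) :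
    CanBeTiledByRatios R.toSet S := by
  refine CanBeTiledByRatios.of_finite (ι := Unit) (fun _ => R) (iUnion_const _) ?_ fun _ => h
  intro i j hij
  exact absurd (Subsingleton.elim i j) hij

namespace AxisRect

theorem ratio_pos (R : AxisRect) : 0 < R.ratio :=
  div_pos (sub_pos.2 R.left_lt_right) (sub_pos.2 R.bottom_lt_top)

/-- The image of `R` under `(x, y) ↦ (k * x + a, k * y + b)`. -/
def homothety (k : ℝ) (hk : 0 < k) (a b : ℝ) (R : AxisRect) : AxisRect where
  left := k * R.left + a
  right := k * R.right + a
  bottom := k * R.bottom + b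
  top := k * R.top + b
  left_lt_right := by have := mul_lt_mul_of_pos_left R.left_lt_right hk; linarith
  bottom_lt_top := by have := mul_lt_mul_of_pos_left R.bottom_lt_top hk; linarith

theorem ratio_homothety (k : ℝ) (hk : 0 < k) (a b : ℝ) (R : AxisRect) :
    (R.homothety k hk a b).ratio = R.ratio := by
  simp only [ratio, homothety]
  rw [add_sub_add_right_eq_sub, add_sub_add_right_eq_sub, ← mul_sub, ← mul_sub,
    mul_div_mul_left _ _ hk.ne']

theorem mem_toSet_homothety (k : ℝ) (hk : 0 < k) (a b : ℝ) (R : AxisRect) (z : ℝ × ℝ) :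
    z ∈ (R.homothety k hk a b).toSet ↔ ((z.1 - a) / k, (z.2 - b) / k) ∈ R.toSet := by
  simp only [toSet, homothety, mem_prod, mem_Icc, le_div_iff₀ hk, div_le_iff₀ hk]
  constructor <;> rintro ⟨⟨h1, h2⟩, h3, h4⟩ <;> refine ⟨⟨?_, ?_⟩, ?_, ?_⟩ <;> linarith

theorem mem_interior_homothety (k : ℝ) (hk : 0 < k) (a b : ℝ) (R : AxisRect) (z : ℝ × ℝ) :
    z ∈ interior (R.homothety k hk a b).toSet ↔
      ((z.1 - a) / k, (z.2 - b) / k) ∈ interior R.toSet := by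
  simp only [interior_toSet, homothety, mem_prod, mem_Ioo, lt_div_iff₀ hk, div_lt_iff₀ hk]
  constructor <;> rintro ⟨⟨h1, h2⟩, h3, h4⟩ <;> refine ⟨⟨?_, ?_⟩, ?_, ?_⟩ <;> linarith

/-- The reflection of `R` in the diagonal. -/
def swap (R : AxisRect) : AxisRect where
  left := R.bottom
  right := R.top
  bottom := R.left
  top := R.right
  left_lt_right := R.bottom_lt_top
  bottom_lt_top := R.left_lt_right

theorem ratio_swap (R : AxisRect) : R.swap.ratio = R.ratio⁻¹ := by
  simp [ratio, swap]

theorem mem_toSet_swap (R : AxisRect) (z : ℝ × ℝ) : z ∈ R.swap.toSet ↔ z.swap ∈ R.toSet := by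
  simp [toSet, swap]

theorem mem_interior_swap (R : AxisRect) (z : ℝ × ℝ) :
    z ∈ interior R.swap.toSet ↔ z.swap ∈ interior R.toSet := by
  simp [interior_toSet, swap, and_comm]

theorem canBeTiled_homothety {S : Set ℝ} {R : AxisRect} (k : ℝ) (hk : 0 < k) (a b : ℝ)
    (h : CanBeTiledByRatios R.toSet S) :
    CanBeTiledByRatios (R.homothety k hk a b).toSet S := by
  obtain ⟨m, T, hT, hS⟩ := h
  refine ⟨m, fun i => (T i).homothety k hk a b, ⟨?_, ?_⟩, fun i => ?_⟩
  · ext z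
    simp only [mem_iUnion, mem_toSet_homothety, ← hT.cover]
  · intro i j hij
    rw [Set.disjoint_left]
    intro z hz hz'
    rw [mem_interior_homothety] at hz hz'
    exact Set.disjoint_left.1 (hT.nonoverlapping hij) hz hz'
  · rw [ratio_homothety]
    exact hS i

theorem canBeTiled_swap {S : Set ℝ} (hS : ∀ x ∈ S, x⁻¹ ∈ S) {R : AxisRect}
    (h : CanBeTiledByRatios R.toSet S) : CanBeTiledByRatios R.swap.toSet S := by
  obtain ⟨m, T, hT, hm⟩ := h
  refine ⟨m, fun i => (T i).swap, ⟨?_, ?_⟩, fun i => ?_⟩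
  · ext z
    simp only [mem_iUnion, mem_toSet_swap, ← hT.cover]
  · intro i j hij
    rw [Set.disjoint_left]
    intro z hz hz'
    rw [mem_interior_swap] at hz hz'
    exact Set.disjoint_left.1 (hT.nonoverlapping hij) hz hz'
  · rw [ratio_swap]
    exact hS _ (hm i)

theorem canBeTiled_of_ratio_eq {S : Set ℝ} {R T : AxisRect} (hRT : R.ratio = T.ratio)
    (h : CanBeTiledByRatios R.toSet S) : CanBeTiledByRatios T.toSet S := by
  have hr := sub_pos.2 R.bottom_lt_top
  have ht := sub_pos.2 T.bottom_lt_top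
  set k := (T.top - T.bottom) / (R.top - R.bottom) with hk
  have hk0 : 0 < k := div_pos ht hr
  have h1 : k * (R.top - R.bottom) = T.top - T.bottom := div_mul_cancel₀ _ hr.ne'
  have h2 : k * (R.right - R.left) = T.right - T.left := by
    rw [ratio, ratio, div_eq_div_iff hr.ne' ht.ne'] at hRT
    rw [hk, div_mul_eq_mul_div, div_eq_iff hr.ne', ← hRT]
    ring
  have := canBeTiled_homothety k hk0 (T.left - k * R.left) (T.bottom - k * R.bottom) h
  convert this using 2
  cases T
  simp only [homothety, mk.injEq] at h1 h2 ⊢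
  refine ⟨?_, ?_, ?_, ?_⟩ <;> linarith

/-- The part of `R` to the left of a vertical line. -/
def leftPart (R : AxisRect) (x : ℝ) (h : R.left < x) : AxisRect :=
  { R with right := x, left_lt_right := h }

/-- The part of `R` to the right of a vertical line. -/
def rightPart (R : AxisRect) (x : ℝ) (h : x < R.right) : AxisRect :=
  { R with left := x, left_lt_right := h }

end AxisRect

/-- Every rectangle of ratio `r` can be tiled by rectangles of ratios in `S`. -/
def IsTileableRatio (S : Set ℝ) (r : ℝ) : Prop :=
  ∀ R : AxisRect, R.ratio = r → CanBeTiledByRatios R.toSet S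

namespace IsTileableRatio

variable {S : Set ℝ} {r s : ℝ}

theorem of_mem (h : r ∈ S) : IsTileableRatio S r :=
  fun R hR => CanBeTiledByRatios.self R (hR ▸ h)

theorem of_canBeTiled {R : AxisRect} (h : CanBeTiledByRatios R.toSet S) :
    IsTileableRatio S R.ratio :=
  fun _ hT => AxisRect.canBeTiled_of_ratio_eq hT.symm h

theorem inv (hS : ∀ x ∈ S, x⁻¹ ∈ S) (h : IsTileableRatio S r) : IsTileableRatio S r⁻¹ := by
  intro R hR
  have : R.swap.ratio = r := by rw [AxisRect.ratio_swap, hR, inv_inv]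
  exact AxisRect.canBeTiled_swap hS (h _ this)

theorem add (hr0 : 0 < r) (hs0 : 0 < s) (hr : IsTileableRatio S r) (hs : IsTileableRatio S s) :
    IsTileableRatio S (r + s) := by
  intro R hR
  have hh : 0 < R.top - R.bottom := sub_pos.2 R.bottom_lt_top
  have hw : R.right - R.left = (r + s) * (R.top - R.bottom) := by
    rw [← hR, AxisRect.ratio, div_mul_cancel₀ _ hh.ne']
  have hx1 : R.left < R.left + r * (R.top - R.bottom) := by
    have := mul_pos hr0 hh
    linarith
  have hx2 : R.left + r * (R.top - R.bottom) < R.right := by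
    have := mul_pos hs0 hh
    linarith
  set x := R.left + r * (R.top - R.bottom) with hx
  refine CanBeTiledByRatios.of_subtilings (ι := Bool)
    (fun i => cond i (R.leftPart x hx1) (R.rightPart x hx2)) ?_ ?_ ?_
  · have : (⋃ i, (cond i (R.leftPart x hx1) (R.rightPart x hx2)).toSet) =
        (R.leftPart x hx1).toSet ∪ (R.rightPart x hx2).toSet := by
      rw [union_eq_iUnion]
      exact iUnion_congr fun i => by cases i <;> rfl
    rw [this]
    simp only [AxisRect.toSet, AxisRect.leftPart, AxisRect.rightPart]
    rw [← union_prod, Icc_union_Icc_eq_Icc hx1.le hx2.le]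
  · have hd : Disjoint (interior (R.leftPart x hx1).toSet) (interior (R.rightPart x hx2).toSet) := by
      rw [Set.disjoint_left, AxisRect.interior_toSet, AxisRect.interior_toSet]
      rintro z ⟨⟨-, h1⟩, -⟩ ⟨⟨h2, -⟩, -⟩
      exact lt_asymm h1 h2
    rintro (_ | _) (_ | _) hij
    · exact absurd rfl hij
    · exact hd.symm
    · exact hd
    · exact absurd rfl hij
  · rintro (_ | _)
    · refine hs _ ?_
      rw [AxisRect.ratio, div_eq_iff (sub_pos.2 (AxisRect.bottom_lt_top _)).ne']
      simp only [AxisRect.rightPart, cond_false]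
      linarith
    · refine hr _ ?_
      rw [AxisRect.ratio, div_eq_iff (sub_pos.2 (AxisRect.bottom_lt_top _)).ne']
      simp only [AxisRect.leftPart, cond_true]
      linarith

theorem nat_mul (hr0 : 0 < r) (hr : IsTileableRatio S r) (n : ℕ) :
    IsTileableRatio S ((n + 1 : ℕ) * r) := by
  induction n with
  | zero => simpa using hr
  | succ n ih =>
    have := ih.add (by positivity) hr0 hr
    convert this using 1
    push_cast
    ring

theorem rat_mul (hS : ∀ x ∈ S, x⁻¹ ∈ S) (hr0 : 0 < r) (hr : IsTileableRatio S r) {q : ℚ}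
    (hq : 0 < q) : IsTileableRatio S (q * r) := by
  obtain ⟨d, hd⟩ := Nat.exists_eq_succ_of_ne_zero q.den_nz
  obtain ⟨n, hn⟩ : ∃ n : ℕ, q.num = (n + 1 : ℕ) :=
    ⟨q.num.toNat - 1, by have := Rat.num_pos.2 hq; omega⟩
  -- Division by the denominator is multiplication between two inversions. `nat_mul` at n multiplies
  -- by n + 1, so the predecessors of numerator and denominator are used.
  have h1 := ((hr.inv hS).nat_mul (inv_pos.2 hr0) d).inv hS
  have h2 := h1.nat_mul (by positivity) n
  convert h2 using 1
  have hq' : (q : ℝ) = q.num / q.den := by exact_mod_cast (Rat.num_div_den q).symm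
  rw [hq', hn, hd, mul_inv, inv_inv, Int.cast_natCast, Nat.succ_eq_add_one]
  ring

end IsTileableRatio

/-! ### Cutting a rational orthogonal polygon into congruent squares -/

/-- The square with side `d` and lower left corner `(p.1 * d, p.2 * d)`. -/
def gridSquare (d : ℝ) (hd : 0 < d) (p : ℤ × ℤ) : AxisRect where
  left := p.1 * d
  right := (p.1 + 1) * d
  bottom := p.2 * d
  top := (p.2 + 1) * d
  left_lt_right := by nlinarith
  bottom_lt_top := by nlinarith

theorem floor_eq_of_mem_Ioo {d x : ℝ} (hd : 0 < d) {a : ℤ}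
    (h : x ∈ Ioo ((a : ℝ) * d) ((a + 1) * d)) : ⌊x / d⌋ = a := by
  rw [Int.floor_eq_iff, le_div_iff₀ hd, div_lt_iff₀ hd]
  exact ⟨h.1.le, h.2⟩

theorem dense_notMem_multiples (d : ℝ) : Dense {x : ℝ | ∀ k : ℤ, x ≠ k * d} := by
  have : {x : ℝ | ∀ k : ℤ, x ≠ k * d} = (range fun k : ℤ => (k : ℝ) * d)ᶜ := by
    ext x
    simp [eq_comm]
  rw [this]
  exact (countable_range _).dense_compl ℝ

theorem exists_gridSquare_of_notMem_multiples {d : ℝ} (hd : 0 < d) {z : ℝ × ℝ}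
    (h1 : ∀ k : ℤ, z.1 ≠ k * d) (h2 : ∀ k : ℤ, z.2 ≠ k * d) :
    ∃ p, z ∈ interior (gridSquare d hd p).toSet := by
  refine ⟨(⌊z.1 / d⌋, ⌊z.2 / d⌋), ?_⟩
  rw [AxisRect.interior_toSet]
  refine ⟨⟨lt_of_le_of_ne ?_ (h1 _).symm, ?_⟩, lt_of_le_of_ne ?_ (h2 _).symm, ?_⟩
  · exact (le_div_iff₀ hd).1 (Int.floor_le _)
  · exact (div_lt_iff₀ hd).1 (Int.lt_floor_add_one _)
  · exact (le_div_iff₀ hd).1 (Int.floor_le _)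
  · exact (div_lt_iff₀ hd).1 (Int.lt_floor_add_one _)

theorem gridSquare_nonoverlapping {d : ℝ} (hd : 0 < d) :
    Pairwise fun p q => Disjoint (interior (gridSquare d hd p).toSet)
      (interior (gridSquare d hd q).toSet) := by
  intro p q hpq
  rw [Set.disjoint_left, AxisRect.interior_toSet, AxisRect.interior_toSet]
  rintro z ⟨h1, h2⟩ ⟨h3, h4⟩
  exact hpq (Prod.ext ((floor_eq_of_mem_Ioo hd h1).symm.trans (floor_eq_of_mem_Ioo hd h3))
    ((floor_eq_of_mem_Ioo hd h2).symm.trans (floor_eq_of_mem_Ioo hd h4)))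

theorem AxisRect.closure_interior_toSet (R : AxisRect) : closure (interior R.toSet) = R.toSet := by
  rw [interior_toSet, closure_prod_eq, closure_Ioo R.left_lt_right.ne,
    closure_Ioo R.bottom_lt_top.ne, toSet]

/-- A regular compact set whose frontier lies on the lines of a square grid is a finite union of
squares of the grid. -/
theorem exists_finite_gridSquares {P : Set (ℝ × ℝ)} {d : ℝ} (hd : 0 < d) (hP : IsCompact P)
    (hreg : closure (interior P) = P)
    (hfr : ∀ z ∈ frontier P, (∃ k : ℤ, z.1 = k * d) ∨ ∃ k : ℤ, z.2 = k * d) :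
    ∃ F : Set (ℤ × ℤ), F.Finite ∧ ⋃ p : F, (gridSquare d hd p).toSet = P := by
  set F : Set (ℤ × ℤ) := {p | (gridSquare d hd p).toSet ⊆ P} with hF
  have hfin : F.Finite := by
    obtain ⟨r, hr⟩ := hP.isBounded.subset_closedBall 0
    have hb : ∀ a : ℤ, |(a : ℝ) * d| ≤ r → a ∈ Icc ⌈-(r / d)⌉ ⌊r / d⌋ := by
      intro a ha
      rw [abs_le] at ha
      refine ⟨Int.ceil_le.2 ?_, Int.le_floor.2 ?_⟩
      · rw [← neg_div, div_le_iff₀ hd]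
        exact ha.1
      · rw [le_div_iff₀ hd]
        exact ha.2
    refine ((finite_Icc ⌈-(r / d)⌉ ⌊r / d⌋).prod (finite_Icc ⌈-(r / d)⌉ ⌊r / d⌋)).subset ?_
    intro p hp
    have hmem : ((p.1 : ℝ) * d, (p.2 : ℝ) * d) ∈ (gridSquare d hd p).toSet :=
      ⟨⟨le_rfl, (gridSquare d hd p).left_lt_right.le⟩,
        ⟨le_rfl, (gridSquare d hd p).bottom_lt_top.le⟩⟩
    have := hr (hp hmem)
    rw [mem_closedBall_zero_iff, Prod.norm_def, max_le_iff, Real.norm_eq_abs,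
      Real.norm_eq_abs] at this
    exact ⟨hb _ this.1, hb _ this.2⟩
  refine ⟨F, hfin, subset_antisymm (iUnion_subset fun p => p.2) ?_⟩
  have : Finite F := hfin
  have hclosed : IsClosed (⋃ p : F, (gridSquare d hd p).toSet) :=
    isClosed_iUnion_of_finite fun p => isClosed_Icc.prod isClosed_Icc
  -- Points off the grid lines are dense, so by regularity of P it suffices to cover those lying in
  -- its interior.
  set G : Set (ℝ × ℝ) := {x : ℝ | ∀ k : ℤ, x ≠ k * d} ×ˢ {x : ℝ | ∀ k : ℤ, x ≠ k * d} with hG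
  have hGd : Dense G := (dense_notMem_multiples d).prod (dense_notMem_multiples d)
  have hsub : interior P ∩ G ⊆ ⋃ p : F, (gridSquare d hd p).toSet := by
    rintro z ⟨hz, hz1, hz2⟩
    obtain ⟨p, hp⟩ := exists_gridSquare_of_notMem_multiples hd hz1 hz2
    have hdisj : ¬ (interior (gridSquare d hd p).toSet ∩ frontier P).Nonempty := by
      rintro ⟨w, hw, hwf⟩
      rw [AxisRect.interior_toSet] at hw
      have hne : ∀ {a k : ℤ} {x : ℝ}, x ∈ Ioo ((a : ℝ) * d) ((a + 1) * d) → x ≠ k * d := by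
        rintro a k x ⟨h1, h2⟩ rfl
        have h1 := lt_of_mul_lt_mul_right h1 hd.le
        have h2 := lt_of_mul_lt_mul_right h2 hd.le
        norm_cast at h1 h2
        omega
      rcases hfr w hwf with ⟨k, hk⟩ | ⟨k, hk⟩
      · exact hne hw.1 hk
      · exact hne hw.2 hk
    -- An open cell is connected and misses the frontier, so once it meets the interior of P it lies
    -- in P.
    have hconn : IsPreconnected (interior (gridSquare d hd p).toSet) := by
      rw [AxisRect.interior_toSet]
      exact isPreconnected_Ioo.prod isPreconnected_Ioo
    have hin : interior (gridSquare d hd p).toSet ⊆ P := by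
      by_contra hnot
      obtain ⟨w, hw, hwP⟩ := Set.not_subset.1 hnot
      have hcov : interior (gridSquare d hd p).toSet ⊆ interior P ∪ Pᶜ := fun u hu => by
        by_contra! hc
        rw [mem_union, not_or, notMem_compl_iff] at hc
        exact hdisj ⟨u, hu, subset_closure hc.2, hc.1⟩
      obtain ⟨u, -, hu, hu'⟩ := hconn _ _ isOpen_interior hP.isClosed.isOpen_compl hcov
        ⟨z, hp, hz⟩ ⟨w, hw, hwP⟩
      exact hu' (interior_subset hu)
    have hpF : p ∈ F := by
      rw [hF, mem_ofPred_eq, ← AxisRect.closure_interior_toSet]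
      exact closure_minimal hin hP.isClosed
    exact mem_iUnion.2 ⟨⟨p, hpF⟩, interior_subset hp⟩
  calc P = closure (interior P) := hreg.symm
    _ ⊆ closure (interior P ∩ G) :=
      closure_minimal (hGd.open_subset_closure_inter isOpen_interior) isClosed_closure
    _ ⊆ _ := closure_minimal hsub hclosed

namespace Polygon

variable {n : ℕ} {v : Polygon (ℝ × ℝ) n}

theorem mem_boundary_of_isOrthogonal (horth : v.IsOrthogonal) {z : ℝ × ℝ}
    (hz : z ∈ v.boundary ℝ) : ∃ i, z.1 = (v i).1 ∨ z.2 = (v i).2 := by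
  obtain ⟨i, t, -, rfl⟩ := mem_iUnion.1 hz
  refine ⟨i, ?_⟩
  rcases horth i with ⟨h, -⟩ | ⟨h, -⟩
  · right
    have h : (v i).2 = (v (finRotate n i)).2 := h
    simp [AffineMap.lineMap_apply, -finRotate_apply, ← h]
  · left
    have h : (v i).1 = (v (finRotate n i)).1 := h
    simp [AffineMap.lineMap_apply, -finRotate_apply, ← h]

theorem exists_common_denominator (hrat : v.HasRationalVertices) :
    ∃ N : ℕ, 0 < N ∧ ∀ i, (∃ k : ℤ, (v i).1 = k * (1 / N : ℝ)) ∧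
      ∃ k : ℤ, (v i).2 = k * (1 / N : ℝ) := by
  choose p q hpq using hrat
  have key : ∀ (r : ℚ) (N : ℕ), 0 < N → r.den ∣ N → ∃ k : ℤ, (r : ℝ) = k * (1 / N : ℝ) := by
    rintro r _ hN ⟨m, rfl⟩
    refine ⟨r.num * m, ?_⟩
    have hm : (m : ℝ) ≠ 0 := by
      rintro h
      have : m = 0 := by exact_mod_cast h
      simp [this] at hN
    have hr : (r : ℝ) = r.num / r.den := by exact_mod_cast (Rat.num_div_den r).symm
    have hd : (r.den : ℝ) ≠ 0 := by exact_mod_cast r.den_nz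
    rw [hr]
    push_cast
    field_simp
  have hN : 0 < ∏ i, ((p i).den * (q i).den) :=
    Finset.prod_pos fun i _ => mul_pos (p i).den_pos (q i).den_pos
  refine ⟨∏ i, ((p i).den * (q i).den), hN, fun i => ?_⟩
  have hdvd := Finset.dvd_prod_of_mem (fun i => (p i).den * (q i).den) (Finset.mem_univ i)
  rw [hpq i]
  exact ⟨key _ _ hN ((dvd_mul_right _ _).trans hdvd), key _ _ hN ((dvd_mul_left _ _).trans hdvd)⟩

/-- The region of an orthogonal polygon with rational vertices is tiled by congruent squares with
rational sides. -/
theorem exists_square_tiling {P : Set (ℝ × ℝ)} (hP : v.IsSimpleRegion P) (horth : v.IsOrthogonal)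
    (hrat : v.HasRationalVertices) :
    ∃ (N m : ℕ) (R : Fin m → AxisRect), 0 < N ∧ 0 < m ∧ IsTiling P R ∧
      ∀ i, (R i).right - (R i).left = 1 / N ∧ (R i).top - (R i).bottom = 1 / N := by
  obtain ⟨N, hN, hv⟩ := exists_common_denominator hrat
  have hd : (0 : ℝ) < 1 / N := by positivity
  obtain ⟨F, hF, hcover⟩ := exists_finite_gridSquares hd hP.isCompact hP.closure_interior_eq
    (fun z hz => by
      rw [hP.frontier_eq] at hz
      obtain ⟨i, hi | hi⟩ := mem_boundary_of_isOrthogonal horth hz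
      · exact Or.inl (hi ▸ (hv i).1)
      · exact Or.inr (hi ▸ (hv i).2))
  have : Finite F := hF
  obtain ⟨m, ⟨e⟩⟩ := Finite.exists_equiv_fin F
  refine ⟨N, m, fun i => gridSquare _ hd (e.symm i), hN, ?_, ⟨?_, ?_⟩, fun i => ?_⟩
  -- Without squares P would be empty, yet its frontier contains a vertex.
  · rw [Nat.pos_iff_ne_zero]
    rintro rfl
    have hPe : P = ∅ := by
      rw [← hcover, iUnion_eq_empty]
      exact fun p => (e p).elim0
    have h3 := hP.isSimpleClosed.three_le
    have hfr : v ⟨0, by omega⟩ ∈ frontier P := by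
      rw [hP.frontier_eq]
      exact mem_iUnion.2 ⟨⟨0, by omega⟩, left_mem_affineSegment _ _ _⟩
    simp [hPe] at hfr
  · rw [← hcover]
    exact e.symm.surjective.iUnion_comp fun p : F => (gridSquare _ hd p).toSet
  · intro i j hij
    exact gridSquare_nonoverlapping hd fun h => hij (e.symm.injective (Subtype.ext h))
  · simp only [gridSquare]
    constructor <;> ring

end Polygon

/-! ### Quotients with positive real part: degrees and leading coefficients -/

/-- The quotient of two polynomials maps the right half-plane to itself. -/
def HasPositiveRatio (A B : ℚ[X]) : Prop :=
  ∀ z : ℂ, 0 < z.re → 0 < (aeval z A / aeval z B).re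

namespace HasPositiveRatio

variable {A B : ℚ[X]}

theorem aeval_left_ne_zero (h : HasPositiveRatio A B) {z : ℂ} (hz : 0 < z.re) :
    aeval z A ≠ 0 := fun h0 => by
  have := h z hz
  simp [h0] at this

theorem aeval_right_ne_zero (h : HasPositiveRatio A B) {z : ℂ} (hz : 0 < z.re) :
    aeval z B ≠ 0 := fun h0 => by
  have := h z hz
  simp [h0] at this

theorem left_ne_zero (h : HasPositiveRatio A B) : A ≠ 0 := fun h0 => by
  have := h 1 (by simp)
  simp [h0] at this

theorem right_ne_zero (h : HasPositiveRatio A B) : B ≠ 0 := fun h0 => by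
  have := h 1 (by simp)
  simp [h0] at this

theorem swap (h : HasPositiveRatio A B) : HasPositiveRatio B A := fun z hz => by
  rw [← inv_div, Complex.inv_re]
  exact div_pos (h z hz)
    (Complex.normSq_pos.2 (div_ne_zero (h.aeval_left_ne_zero hz) (h.aeval_right_ne_zero hz)))

theorem ratio_pos (h : HasPositiveRatio A B) {c : ℝ} (hc : 0 < c) :
    0 < aeval c A / aeval c B := by
  have := h (c : ℂ) (by simpa using hc)
  rw [← Complex.coe_algebraMap, aeval_algebraMap_apply, aeval_algebraMap_apply, ← map_div₀] at this
  simpa using this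

end HasPositiveRatio

theorem tendsto_aeval_div_pow {A B : ℚ[X]} {k : ℕ} (hB : B ≠ 0)
    (hdeg : A.natDegree = B.natDegree + k) :
    Tendsto (fun z : ℂ => aeval z A / aeval z B / z ^ k) (cobounded ℂ)
      (𝓝 ((A.leadingCoeff / B.leadingCoeff : ℚ) : ℂ)) := by
  have hA' := isEquivalent_cobounded_leading_monomial (P := A.map (algebraMap ℚ ℂ))
  have hB' := isEquivalent_cobounded_leading_monomial (P := B.map (algebraMap ℚ ℂ))
  have h := (hA'.div hB').div (Asymptotics.IsEquivalent.refl (u := fun z : ℂ => z ^ k))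
  have hfun : (fun z : ℂ => aeval z A / aeval z B / z ^ k) =
      ((eval · (A.map (algebraMap ℚ ℂ))) / (eval · (B.map (algebraMap ℚ ℂ)))) /
        (fun z : ℂ => z ^ k) := by
    ext z
    simp [aeval_def, eval_map]
  rw [hfun]
  refine h.symm.tendsto_nhds ?_
  refine Tendsto.congr' ?_ tendsto_const_nhds
  filter_upwards [eventually_ne_cobounded (0 : ℂ)] with z hz
  have hb : (B.leadingCoeff : ℂ) ≠ 0 := by exact_mod_cast leadingCoeff_ne_zero.2 hB
  simp only [Pi.div_apply, leadingCoeff_map, natDegree_map, hdeg, eq_ratCast]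
  push_cast
  field_simp
  ring

namespace HasPositiveRatio

variable {A B : ℚ[X]}

/-- Along the ray tω the quotient divided by the positive number t^k tends to the displayed value,
so its sign survives in the limit. -/
theorem re_leadingCoeff_mul_pow_nonneg (h : HasPositiveRatio A B) {k : ℕ}
    (hdeg : A.natDegree = B.natDegree + k) {ω : ℂ} (hω : 0 < ω.re) :
    0 ≤ (((A.leadingCoeff / B.leadingCoeff : ℚ) : ℂ) * ω ^ k).re := by
  have hω0 : ω ≠ 0 := by
    rintro rfl
    simp at hω
  have ht : Tendsto (fun t : ℝ => (t : ℂ) * ω) atTop (cobounded ℂ) := by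
    rw [← tendsto_norm_atTop_iff_cobounded]
    simp only [norm_mul, Complex.norm_real, Real.norm_eq_abs]
    exact tendsto_abs_atTop_atTop.atTop_mul_const (norm_pos_iff.2 hω0)
  have h1 := ((tendsto_aeval_div_pow h.right_ne_zero hdeg).comp ht).mul_const (ω ^ k)
  have h2 := (Complex.continuous_re.tendsto _).comp h1
  refine ge_of_tendsto h2 ?_
  filter_upwards [eventually_gt_atTop (0 : ℝ)] with t ht0
  have hpos := h (t * ω) (by rw [Complex.re_ofReal_mul]; exact mul_pos ht0 hω)
  have ht0' : (t : ℂ) ≠ 0 := by exact_mod_cast ht0.ne'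
  have : aeval (t * ω) A / aeval (t * ω) B / (t * ω) ^ k * ω ^ k =
      ((t ^ k)⁻¹ : ℝ) * (aeval (t * ω) A / aeval (t * ω) B) := by
    push_cast
    field_simp
    ring
  simp only [Function.comp_apply]
  rw [this, Complex.re_ofReal_mul]
  exact mul_nonneg (by positivity) hpos.le

theorem leadingCoeff_div_pos (h : HasPositiveRatio A B) (hdeg : B.natDegree ≤ A.natDegree) :
    0 < A.leadingCoeff / B.leadingCoeff := by
  obtain ⟨k, hk⟩ := Nat.exists_eq_add_of_le hdeg
  have h1 := h.re_leadingCoeff_mul_pow_nonneg hk (ω := 1) (by simp)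
  rw [one_pow, mul_one, Complex.ratCast_re] at h1
  have h2 : 0 ≤ A.leadingCoeff / B.leadingCoeff := by exact_mod_cast h1
  exact lt_of_le_of_ne h2 (div_ne_zero (leadingCoeff_ne_zero.2 h.left_ne_zero)
    (leadingCoeff_ne_zero.2 h.right_ne_zero)).symm

/-- For k ≥ 3 the number ω = exp(iπ/k) still lies in the open right half-plane but ω^k = -1, against
positivity of the leading quotient. At k = 2 this ω falls on the imaginary axis; parity excludes
that case later. -/
theorem natDegree_le_add_two (h : HasPositiveRatio A B) :
    A.natDegree ≤ B.natDegree + 2 := by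
  by_contra! hlt
  obtain ⟨k, hk⟩ := Nat.exists_eq_add_of_le (show B.natDegree ≤ A.natDegree by omega)
  have hk3 : 3 ≤ k := by omega
  have hk0 : (k : ℂ) ≠ 0 := by
    have : k ≠ 0 := by omega
    exact_mod_cast this
  have hk3' : (3 : ℝ) ≤ k := by exact_mod_cast hk3
  set ω : ℂ := Complex.exp ((Real.pi / k : ℝ) * Complex.I) with hω
  have hωre : 0 < ω.re := by
    rw [hω, Complex.exp_ofReal_mul_I_re]
    apply Real.cos_pos_of_mem_Ioo
    have hpi := Real.pi_pos
    constructor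
    · have : 0 < Real.pi / k := by positivity
      linarith
    · rw [div_lt_div_iff₀ (by positivity) (by positivity)]
      nlinarith
  have hωk : ω ^ k = -1 := by
    rw [hω, ← Complex.exp_nat_mul, ← Complex.exp_pi_mul_I]
    congr 1
    push_cast
    field_simp
  have h1 := h.re_leadingCoeff_mul_pow_nonneg hk hωre
  have h2 := h.leadingCoeff_div_pos (by omega)
  rw [hωk, mul_neg_one, Complex.neg_re, Complex.ratCast_re] at h1
  have h3 : (0 : ℝ) < (A.leadingCoeff / B.leadingCoeff : ℚ) := by exact_mod_cast h2
  linarith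

end HasPositiveRatio

/-! ### The Euclidean step, by Phragmén–Lindelöf -/

/-- A holomorphic function on the right half-plane which tends to zero at infinity and whose real
part has nonnegative lower limits on the imaginary axis has nonnegative real part. -/
theorem re_nonneg_of_neg_mul_re_le {h : ℂ → ℂ} {d : ℝ}
    (hh : DifferentiableOn ℂ h {z | 0 < z.re})
    (hd : ∀ z : ℂ, 0 < z.re → -(d * z.re) ≤ (h z).re)
    (h0 : Tendsto h (cobounded ℂ) (𝓝 0)) {z : ℂ} (hz : 0 < z.re) : 0 ≤ (h z).re := by
  have key : ∀ ε : ℝ, 0 < ε → ε < z.re → -(d * ε) ≤ (h z).re := by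
    intro ε hε hεz
    -- The shift by ε brings the boundary line inside the domain, where Re h ≥ -dε. The norm of f is
    -- exp(-Re h), so an upper bound for it is a lower bound for Re h; afterwards ε tends to 0.
    set f : ℂ → ℂ := fun w => Complex.exp (-h (w + ε)) with hf
    have hshift : Tendsto (fun w : ℂ => w + ε) (cobounded ℂ) (cobounded ℂ) := by
      rw [← tendsto_norm_atTop_iff_cobounded]
      refine tendsto_atTop_mono (fun w => ?_)
        (tendsto_atTop_add_const_right _ (-‖(ε : ℂ)‖) (tendsto_norm_cobounded_atTop (E := ℂ)))
      have := norm_sub_le (w + ε) (ε : ℂ)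
      rw [add_sub_cancel_right] at this
      linarith
    have hlim : Tendsto f (cobounded ℂ) (𝓝 1) := by
      have : Tendsto f (cobounded ℂ) (𝓝 (Complex.exp (-0))) :=
        (Complex.continuous_exp.tendsto _).comp (h0.comp hshift).neg
      simpa using this
    have hdiff : DifferentiableOn ℂ f {w | -ε < w.re} := by
      refine DifferentiableOn.cexp (DifferentiableOn.neg (hh.comp ?_ ?_))
      · fun_prop
      · intro w hw
        have hw : -ε < w.re := hw
        simp only [mem_ofPred_eq, Complex.add_re, Complex.ofReal_re]
        linarith
    have hcl : DiffContOnCl ℂ f {w | 0 < w.re} := by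
      refine DifferentiableOn.diffContOnCl (hdiff.mono ?_)
      rw [Complex.closure_setOfPred_lt_re]
      intro w hw
      have hw : 0 ≤ w.re := hw
      simp only [mem_ofPred_eq]
      linarith
    have hnorm : ∀ w, ‖f w‖ = Real.exp (-(h (w + ε)).re) := fun w => by
      rw [hf, Complex.norm_exp, Complex.neg_re]
    have hle := PhragmenLindelof.right_half_plane_of_bounded_on_real (C := Real.exp (d * ε))
      (z := z - ε) hcl ⟨0, by norm_num, 0, ?_⟩ ?_ ?_ ?_
    · rw [hnorm, Real.exp_le_exp, sub_add_cancel] at hle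
      linarith
    · simp only [zero_mul, Real.exp_zero]
      exact (hlim.isBigO_one ℝ).mono inf_le_left
    · have : Tendsto (fun x : ℝ => ‖f x‖) atTop (𝓝 ‖(1 : ℂ)‖) := by
        refine (hlim.comp ?_).norm
        rw [← tendsto_norm_atTop_iff_cobounded]
        simpa using tendsto_abs_atTop_atTop
      exact this.isBoundedUnder_le
    · intro x
      rw [hnorm, Real.exp_le_exp]
      have := hd (x * Complex.I + ε) (by simpa using hε)
      simp only [Complex.add_re, Complex.re_ofReal_mul, Complex.I_re, mul_zero, zero_add,
        Complex.ofReal_re] at this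
      linarith
    · simp only [Complex.sub_re, Complex.ofReal_re]
      linarith
  have hl : Tendsto (fun ε : ℝ => -(d * ε)) (𝓝[>] 0) (𝓝 0) := by
    have : Tendsto (fun ε : ℝ => -(d * ε)) (𝓝 0) (𝓝 (-(d * 0))) :=
      Continuous.tendsto (by fun_prop) 0
    rw [mul_zero, neg_zero] at this
    exact this.mono_left nhdsWithin_le_nhds
  refine le_of_tendsto hl ?_
  filter_upwards [self_mem_nhdsWithin, nhdsWithin_le_nhds (Iio_mem_nhds hz)] with ε h1 h2
  exact key ε h1 h2

/-- One step of the Euclidean algorithm preserves positivity of the real part. -/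
theorem HasPositiveRatio.sub_monomial_mul {A B : ℚ[X]} (h : HasPositiveRatio A B) (d : ℚ)
    (hne : A - C d * X * B ≠ 0) (hdeg : (A - C d * X * B).degree < B.degree) :
    HasPositiveRatio (A - C d * X * B) B := by
  set A₁ := A - C d * X * B with hA₁
  set g : ℂ → ℂ := fun z => aeval z A₁ / aeval z B with hg
  have hopen : IsOpen {z : ℂ | 0 < z.re} := isOpen_lt continuous_const Complex.continuous_re
  have hgdiff : DifferentiableOn ℂ g {z | 0 < z.re} :=
    DifferentiableOn.div (A₁.differentiable_aeval.differentiableOn)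
      (B.differentiable_aeval.differentiableOn) fun z hz => h.aeval_right_ne_zero hz
  have hg0 : Tendsto g (cobounded ℂ) (𝓝 0) := by
    have hdeg' : (A₁.map (algebraMap ℚ ℂ)).degree < (B.map (algebraMap ℚ ℂ)).degree := by
      rwa [degree_map, degree_map]
    have := (isLittleO_cobounded_of_degree_lt hdeg').tendsto_div_nhds_zero
    refine this.congr fun z => ?_
    simp [hg, aeval_def, eval_map]
  -- Here g = A/B - dz, so Re g ≥ -d Re z, and g vanishes at infinity because the remainder has
  -- smaller degree than B.
  have hgre : ∀ z : ℂ, 0 < z.re → 0 ≤ (g z).re := by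
    intro z hz
    refine re_nonneg_of_neg_mul_re_le (d := d) hgdiff (fun w hw => ?_) hg0 hz
    have hgw : g w = aeval w A / aeval w B - (d : ℝ) * w := by
      have := h.aeval_right_ne_zero hw
      simp only [hg, hA₁, map_sub, map_mul, aeval_C, aeval_X, eq_ratCast, Complex.ofReal_ratCast]
      field_simp
    rw [hgw, Complex.sub_re, Complex.re_ofReal_mul]
    have := h w hw
    linarith
  -- Strictness comes from the open mapping theorem: a nonconstant image is open, hence inside the
  -- open half-plane. A constant would equal the limit 0 and force the nonzero remainder to vanish
  -- on an infinite set.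
  have hpre : IsPreconnected {z : ℂ | 0 < z.re} := (convex_halfSpace_re_gt 0).isPreconnected
  rcases (hgdiff.analyticOnNhd hopen).is_constant_or_isOpen hpre with ⟨w, hw⟩ | himg
  · exfalso
    have ht : Tendsto (fun t : ℝ => (t : ℂ)) atTop (cobounded ℂ) := by
      rw [← tendsto_norm_atTop_iff_cobounded]
      simpa using tendsto_abs_atTop_atTop
    have hw0 : w = 0 := by
      refine tendsto_nhds_unique ?_ (hg0.comp ht)
      refine Tendsto.congr' ?_ tendsto_const_nhds
      filter_upwards [eventually_gt_atTop (0 : ℝ)] with t ht0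
      exact (hw t (by simpa using ht0)).symm
    have hroots : {z : ℂ | 0 < z.re} ⊆ (A₁.map (algebraMap ℚ ℂ)).rootSet ℂ := by
      intro z hz
      rw [mem_rootSet]
      refine ⟨(Polynomial.map_ne_zero_iff (algebraMap ℚ ℂ).injective).2 hne, ?_⟩
      have := hw z hz
      rw [hw0, hg, div_eq_zero_iff, or_iff_left (h.aeval_right_ne_zero hz)] at this
      simpa [aeval_def, eval_map] using this
    have hinf : {z : ℂ | 0 < z.re}.Infinite :=
      infinite_of_mem_nhds (1 : ℂ) (hopen.mem_nhds (by simp))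
    exact hinf ((rootSet_finite _ _).subset hroots)
  · intro z hz
    have h1 := himg _ subset_rfl hopen
    have h2 : g '' {z | 0 < z.re} ⊆ interior {w : ℂ | 0 ≤ w.re} := by
      refine interior_maximal ?_ h1
      rintro _ ⟨w, hw, rfl⟩
      exact hgre w hw
    rw [Complex.interior_setOfPred_le_re] at h2
    exact h2 ⟨z, hz, rfl⟩

/-! ### Parity and the continued fraction expansion -/

/-- All monomials of the polynomial have degrees of the same parity as `e`. -/
def HasParity (A : ℚ[X]) (e : ℕ) : Prop :=
  ∀ n, A.coeff n ≠ 0 → n % 2 = e % 2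

theorem HasParity.natDegree {A : ℚ[X]} {e : ℕ} (h : HasParity A e) (hA : A ≠ 0) :
    A.natDegree % 2 = e % 2 :=
  h _ (leadingCoeff_ne_zero.2 hA)

theorem HasParity.sub_monomial_mul {A B : ℚ[X]} {e : ℕ} (hA : HasParity A (e + 1))
    (hB : HasParity B e) (d : ℚ) : HasParity (A - C d * X * B) (e + 1) := by
  intro n hn
  by_cases h : A.coeff n = 0
  · rw [coeff_sub, h, zero_sub, neg_ne_zero, mul_assoc, coeff_C_mul] at hn
    have hn := right_ne_zero_of_mul hn
    cases n with
    | zero => simp at hn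
    | succ n =>
      rw [coeff_X_mul] at hn
      have := hB n hn
      omega
  · exact hA n h

/-- The value at `c` of a quotient of an odd and an even polynomial with positive real part on the
right half-plane is obtained from `c` by additions, inversions and multiplications by positive
rationals: expand it into a continued fraction. -/
theorem HasPositiveRatio.eval_induction {T : ℝ → Prop} {c : ℝ} (hc : 0 < c) (hTc : T c)
    (hinv : ∀ r, T r → T r⁻¹) (hadd : ∀ r s, 0 < r → 0 < s → T r → T s → T (r + s))
    (hmul : ∀ (q : ℚ) (r), 0 < q → 0 < r → T r → T (q * r)) {A B : ℚ[X]} {e : ℕ}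
    (h : HasPositiveRatio A B) (hA : HasParity A (e + 1)) (hB : HasParity B e) :
    T (aeval c A / aeval c B) := by
  induction hn : A.natDegree + B.natDegree using Nat.strong_induction_on generalizing A B e with
  | _ n ih =>
    have main : ∀ {A B : ℚ[X]} {e : ℕ}, HasPositiveRatio A B → HasParity A (e + 1) →
        HasParity B e → A.natDegree + B.natDegree = n → B.natDegree < A.natDegree →
        T (aeval c A / aeval c B) := by
      intro A B e h hA hB hn hlt
      have h1 := hA.natDegree h.left_ne_zero
      have h2 := hB.natDegree h.right_ne_zero
      have h3 := h.natDegree_le_add_two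
      -- The difference of degrees is positive, at most 2, and odd by parity.
      have hdeg : A.natDegree = B.natDegree + 1 := by omega
      have hd := h.leadingCoeff_div_pos hlt.le
      set d := A.leadingCoeff / B.leadingCoeff with hd_def
      have hBc : aeval c B ≠ 0 := fun h0 => by
        have := h.ratio_pos hc
        simp [h0] at this
      have hTd : T (d * c) := hmul d c hd hc hTc
      have heval : aeval c A / aeval c B = d * c + aeval c (A - C d * X * B) / aeval c B := by
        simp only [map_sub, map_mul, aeval_C, aeval_X, eq_ratCast]
        field_simp
        ring
      by_cases hzero : A - C d * X * B = 0
      · rw [heval, hzero, map_zero, zero_div, add_zero]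
        exact hTd
      · have hBlc := leadingCoeff_ne_zero.2 h.right_ne_zero
        have hCX : (C d * X * B).natDegree = A.natDegree := by
          rw [mul_assoc, natDegree_C_mul hd.ne', natDegree_X_mul h.right_ne_zero, hdeg]
        have hle : (A - C d * X * B).degree < A.degree := by
          refine degree_sub_lt_left ?_ h.left_ne_zero ?_
          · rw [degree_eq_natDegree h.left_ne_zero, degree_eq_natDegree, hCX]
            intro h0
            rw [h0, natDegree_zero] at hCX
            omega
          · rw [leadingCoeff_mul, leadingCoeff_mul, leadingCoeff_C, leadingCoeff_X, mul_one,
              hd_def, div_mul_cancel₀ _ hBlc]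
        have hle' := natDegree_lt_natDegree hzero hle
        -- The remainder has degree at most that of B, and parity rules out equality. So the degree
        -- is strictly smaller, as the Euclidean step requires.
        have hpar := hA.sub_monomial_mul hB d
        have h4 := hpar.natDegree hzero
        have hlt' : (A - C d * X * B).degree < B.degree := by
          rw [degree_eq_natDegree hzero, degree_eq_natDegree h.right_ne_zero]
          exact_mod_cast (by omega : (A - C d * X * B).natDegree < B.natDegree)
        have hpos := h.sub_monomial_mul d hzero hlt'
        rw [heval]
        exact hadd _ _ (mul_pos (by exact_mod_cast hd) hc) (hpos.ratio_pos hc) hTd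
          (ih _ (by omega) hpos hpar hB rfl)
    rcases lt_trichotomy B.natDegree A.natDegree with hlt | heq | hlt
    · exact main h hA hB hn hlt
    · have h1 := hA.natDegree h.left_ne_zero
      have h2 := hB.natDegree h.right_ne_zero
      omega
    -- After inversion B is the numerator; its parity e agrees with e + 2.
    · have := main (e := e + 1) h.swap (fun n hn => by have := hB n hn; omega) hA (by omega) hlt
      rw [← inv_div]
      exact hinv _ this

/-! ### Polynomials with all roots in the right half-plane -/

theorem norm_prod_sub_lt {s : Multiset ℂ} (hs : ∀ r ∈ s, 0 < r.re) (h0 : s ≠ 0) {z : ℂ}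
    (hz : 0 < z.re) :
    ‖(s.map (starRingEnd ℂ z - ·)).prod‖ < ‖(s.map (-z - ·)).prod‖ := by
  -- The points conj z and -z are mirror images in the imaginary axis, and r lies on the side of
  -- conj z. The squared distances differ by 4 Re r Re z.
  have hone : ∀ r : ℂ, 0 < r.re → ‖starRingEnd ℂ z - r‖ < ‖-z - r‖ := by
    intro r hr
    rw [← sq_lt_sq₀ (norm_nonneg _) (norm_nonneg _), ← Complex.normSq_eq_norm_sq,
      ← Complex.normSq_eq_norm_sq, Complex.normSq_apply, Complex.normSq_apply]
    simp only [Complex.sub_re, Complex.sub_im, Complex.conj_re, Complex.conj_im, Complex.neg_re,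
      Complex.neg_im]
    nlinarith [mul_pos hr hz]
  have hle : ∀ s : Multiset ℂ, (∀ r ∈ s, 0 < r.re) →
      ‖(s.map (starRingEnd ℂ z - ·)).prod‖ ≤ ‖(s.map (-z - ·)).prod‖ ∧
        0 < ‖(s.map (-z - ·)).prod‖ := by
    intro s
    induction s using Multiset.induction_on with
    | empty => simp
    | cons a s ih =>
      intro hs
      obtain ⟨h1, h2⟩ := ih fun r hr => hs r (Multiset.mem_cons_of_mem hr)
      have h3 := hone a (hs a (Multiset.mem_cons_self a s))
      simp only [Multiset.map_cons, Multiset.prod_cons, norm_mul]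
      exact ⟨mul_le_mul h3.le h1 (norm_nonneg _) (norm_nonneg _),
        mul_pos ((norm_nonneg _).trans_lt h3) h2⟩
  obtain ⟨a, ha⟩ := Multiset.exists_mem_of_ne_zero h0
  obtain ⟨t, rfl⟩ := Multiset.exists_cons_of_mem ha
  obtain ⟨h1, h2⟩ := hle t fun r hr => hs r (Multiset.mem_cons_of_mem hr)
  simp only [Multiset.map_cons, Multiset.prod_cons, norm_mul]
  exact (mul_le_mul_of_nonneg_left h1 (norm_nonneg _)).trans_lt
    (mul_lt_mul_of_pos_right (hone a (hs a (Multiset.mem_cons_self a t))) h2)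

/-- Since the coefficients are rational, z may be replaced by conj z without changing the norm on
the left. Every root is then closer to conj z than to -z, and the factorization over ℂ compares
factor by factor. -/
theorem norm_aeval_lt_norm_aeval_neg {p : ℚ[X]} (hp : 0 < p.natDegree)
    (hroots : ∀ z : ℂ, aeval z p = 0 → 0 < z.re) {z : ℂ} (hz : 0 < z.re) :
    ‖aeval z p‖ < ‖aeval (-z) p‖ := by
  have hp0 : p ≠ 0 := by
    rintro rfl
    simp at hp
  have hconj : ‖aeval z p‖ = ‖aeval (starRingEnd ℂ z) p‖ := by
    have := aeval_conj (p.map (algebraMap ℚ ℝ)) z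
    rw [aeval_map_algebraMap, aeval_map_algebraMap] at this
    rw [this, RCLike.norm_conj]
  have hsplit := IsAlgClosed.splits (p.map (algebraMap ℚ ℂ))
  rw [hconj, hsplit.aeval_eq_prod_aroots, hsplit.aeval_eq_prod_aroots, norm_mul, norm_mul]
  have hlc : algebraMap ℚ ℂ p.leadingCoeff ≠ 0 :=
    (_root_.map_ne_zero _).2 (leadingCoeff_ne_zero.2 hp0)
  refine mul_lt_mul_of_pos_left (norm_prod_sub_lt (fun r hr => ?_) ?_ hz) (norm_pos_iff.2 hlc)
  · exact hroots r (mem_aroots.1 hr).2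
  · rw [Ne, ← Multiset.card_eq_zero, aroots_def, ← hsplit.natDegree_eq_card_roots, natDegree_map]
    exact hp.ne'

theorem aeval_comp_C_neg_one_mul_X {K : Type*} [Field K] [Algebra ℚ K] (p : ℚ[X]) (z : K) :
    aeval z (p.comp (C (-1) * X)) = aeval (-z) p := by
  simp [aeval_comp]

/-- Splitting `p (-X)` into its even and odd parts gives a quotient with positive real part if all
the roots of `p` lie in the right half-plane. -/
theorem exists_hasPositiveRatio {p : ℚ[X]} (hp : 0 < p.natDegree)
    (hroots : ∀ z : ℂ, aeval z p = 0 → 0 < z.re) {c : ℝ} (hc : aeval c p = 0) :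
    ∃ A B : ℚ[X], HasPositiveRatio A B ∧ HasParity A 0 ∧ HasParity B 1 ∧
      aeval c A = aeval c B := by
  set q := p.comp (C (-1) * X) with hq
  refine ⟨q + p, q - p, fun z hz => ?_, fun n hn => ?_, fun n hn => ?_, ?_⟩
  -- Re((b + a)/(b - a)) = (|b|² - |a|²)/|b - a|².
  · have h := norm_aeval_lt_norm_aeval_neg hp hroots hz
    rw [map_add, map_sub, hq, aeval_comp_C_neg_one_mul_X]
    set a := aeval z p
    set b := aeval (-z) p
    have hab : b - a ≠ 0 := fun h0 => by
      rw [sub_eq_zero.1 h0] at h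
      exact h.false
    rw [← sq_lt_sq₀ (norm_nonneg _) (norm_nonneg _), ← Complex.normSq_eq_norm_sq,
      ← Complex.normSq_eq_norm_sq, Complex.normSq_apply, Complex.normSq_apply] at h
    rw [Complex.div_re, ← add_div]
    refine div_pos ?_ (Complex.normSq_pos.2 hab)
    simp only [Complex.add_re, Complex.sub_re, Complex.add_im, Complex.sub_im]
    nlinarith
  · by_contra hodd
    have : Odd n := Nat.odd_iff.2 (by omega)
    rw [coeff_add, hq, comp_C_mul_X_coeff, this.neg_one_pow] at hn
    simp at hn
  · by_contra heven
    have : Even n := Nat.even_iff.2 (by omega)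
    rw [coeff_sub, hq, comp_C_mul_X_coeff, this.neg_one_pow] at hn
    simp at hn
  · simp [hc]

/-- If all conjugates of the algebraic number `c` have positive real part, then squares can be tiled
by rectangles of ratios `c` and `1 / c`. -/
theorem isTileableRatio_one {c : ℝ} (hc : 0 < c) (halg : IsAlgebraic ℚ c)
    (hre : ∀ z : ℂ, aeval z (minpoly ℚ c) = 0 → 0 < z.re) :
    IsTileableRatio {c, 1 / c} 1 := by
  have hS : ∀ x ∈ ({c, 1 / c} : Set ℝ), x⁻¹ ∈ ({c, 1 / c} : Set ℝ) := by
    rintro x (rfl | rfl) <;> simp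
  obtain ⟨A, B, hAB, hA, hB, hval⟩ := exists_hasPositiveRatio
    (minpoly.natDegree_pos halg.isIntegral) hre (minpoly.aeval ℚ c)
  have hpos := hAB.ratio_pos hc
  -- With `e := 1` the even numerator has parity e + 1 = 2. As p(c) = 0, numerator and denominator
  -- agree at c, so the ratio reached is 1.
  have hT := hAB.eval_induction (T := fun r => 0 < r ∧ IsTileableRatio {c, 1 / c} r) hc
    ⟨hc, IsTileableRatio.of_mem (by simp)⟩
    (fun r hr => ⟨inv_pos.2 hr.1, hr.2.inv hS⟩)
    (fun r s hr hs h1 h2 => ⟨add_pos hr hs, h1.2.add hr hs h2.2⟩)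
    (fun q r hq hr h => ⟨mul_pos (by exact_mod_cast hq) hr, h.2.rat_mul hS hr hq⟩)
    (e := 1) (fun n hn => by have := hA n hn; omega) hB
  have hne : aeval c B ≠ 0 := fun h0 => by simp [h0] at hpos
  rw [hval, div_self hne] at hT
  exact hT.2

/-! ### Field embeddings and additive functions compatible with multiplication by c -/

open IntermediateField in
theorem exists_algEquiv_adjoin_of_transcendental {K L : Type*} [Field K] [Field L] [Algebra K L]
    {x y : L} (hx : Transcendental K x) (hy : Transcendental K y) :
    ∃ φ : K⟮x⟯ ≃ₐ[K] K⟮y⟯, φ (AdjoinSimple.gen K x) = AdjoinSimple.gen K y := by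
  refine ⟨(RatFunc.algEquivOfTranscendental x hx).symm.trans
    (RatFunc.algEquivOfTranscendental y hy), ?_⟩
  apply Subtype.ext
  simp

-- The negative multiplier -c provided here is what contradicts transcendence.
open IntermediateField in
theorem exists_ringHom_adjoin_neg {c : ℝ} (hc : Transcendental ℚ c) :
    ∃ σ : ℚ⟮c⟯ →+* ℂ, σ (AdjoinSimple.gen ℚ c) = -c := by
  have hc' : Transcendental ℚ (-c) := fun h => hc (by simpa using h.neg)
  obtain ⟨φ, hφ⟩ := exists_algEquiv_adjoin_of_transcendental hc hc'
  refine ⟨(Complex.ofRealHom.comp (algebraMap ℚ⟮-c⟯ ℝ)).comp φ.toRingEquiv.toRingHom, ?_⟩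
  have : φ.toRingEquiv.toRingHom (AdjoinSimple.gen ℚ c) = AdjoinSimple.gen ℚ (-c) := hφ
  rw [RingHom.comp_apply, this, RingHom.comp_apply, AdjoinSimple.algebraMap_gen]
  simp

-- The function is σ composed with a ℚ(c)-linear retraction of ℝ onto ℚ(c), which exists because ℝ
-- is a vector space over ℚ(c).
open IntermediateField in
theorem exists_semilinear_addMonoidHom {c : ℝ} {w : ℂ} (σ : ℚ⟮c⟯ →+* ℂ)
    (hσ : σ (AdjoinSimple.gen ℚ c) = w) :
    ∃ f : ℝ →+ ℂ, f 1 = 1 ∧ ∀ x, f (c * x) = w * f x := by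
  obtain ⟨l, hl⟩ := (Algebra.linearMap ℚ⟮c⟯ ℝ).exists_leftInverse_of_injective
    (LinearMap.ker_eq_bot.2 (algebraMap ℚ⟮c⟯ ℝ).injective)
  refine ⟨σ.toAddMonoidHom.comp l.toAddMonoidHom, ?_, fun x => ?_⟩
  · have : l 1 = 1 := by simpa using LinearMap.congr_fun hl 1
    simp [this]
  · have : l (c * x) = AdjoinSimple.gen ℚ c * l x := by
      have := l.map_smul (AdjoinSimple.gen ℚ c) x
      rwa [smul_eq_mul, Algebra.smul_def, AdjoinSimple.algebraMap_gen] at this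
    simp [this, hσ]

/-! ### Positivity of the conjugates, and the theorem -/

/-- A figure that can be tiled by congruent rational squares and by rectangles of ratios `c` and
`1 / c` forces positivity of the multiplier of every additive function with `f (c x) = w f x`. -/
theorem re_pos_of_semilinear {P : Set (ℝ × ℝ)} {N m : ℕ} {R : Fin m → AxisRect} (hN : 0 < N)
    (hm : 0 < m) (hR : IsTiling P R)
    (hsq : ∀ i, (R i).right - (R i).left = 1 / N ∧ (R i).top - (R i).bottom = 1 / N)
    {c : ℝ} (hc : 0 < c) (hP : CanBeTiledByRatios P {c, 1 / c}) {w : ℂ} {f : ℝ →+ ℂ}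
    (hf1 : f 1 = 1) (hf : ∀ x, f (c * x) = w * f x) : 0 < w.re := by
  by_contra! hw
  obtain ⟨k, T, hT, hratio⟩ := hP
  -- Conjugating the second factor turns a tile of ratio c into w|f(height)|² and one of ratio 1/c
  -- into conj(w)|f(width)|². Both have real part Re w times a nonnegative number.
  set g : ℝ →+ ℂ := (starRingEnd ℂ).toAddMonoidHom.comp f with hg
  have hgx : ∀ x, g x = starRingEnd ℂ (f x) := fun x => rfl
  have hsum := congrArg Complex.re (hR.sum_biadditive_eq hT f g)
  rw [Complex.re_sum, Complex.re_sum] at hsum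
  have hneg : ∑ j, ((T j).biadditive f g).re ≤ 0 := by
    refine Finset.sum_nonpos fun j _ => ?_
    have hh := sub_pos.2 (T j).bottom_lt_top
    rw [AxisRect.biadditive, hgx]
    rcases hratio j with h | h
    · rw [AxisRect.ratio, div_eq_iff hh.ne'] at h
      rw [h, hf, mul_assoc, Complex.mul_conj, Complex.re_mul_ofReal]
      exact mul_nonpos_of_nonpos_of_nonneg hw (Complex.normSq_nonneg _)
    · have h : (T j).ratio = 1 / c := h
      rw [AxisRect.ratio, div_eq_div_iff hh.ne' hc.ne', one_mul, mul_comm] at h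
      rw [← h, hf, map_mul, mul_left_comm, Complex.mul_conj, Complex.re_mul_ofReal,
        Complex.conj_re]
      exact mul_nonpos_of_nonpos_of_nonneg hw (Complex.normSq_nonneg _)
  have hpos : 0 < ∑ i, ((R i).biadditive f g).re := by
    -- N·f(1/N) = f(1) = 1, so every square contributes |f(1/N)|² > 0.
    have hfN : f (1 / N : ℝ) ≠ 0 := by
      intro h0
      have h1 : N • f (1 / N : ℝ) = 1 := by
        rw [← map_nsmul, nsmul_eq_mul, mul_one_div_cancel (by exact_mod_cast hN.ne'), hf1]
      rw [h0, smul_zero] at h1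
      exact zero_ne_one h1
    have : Nonempty (Fin m) := ⟨⟨0, hm⟩⟩
    refine Finset.sum_pos (fun i _ => ?_) Finset.univ_nonempty
    rw [AxisRect.biadditive, hgx, (hsq i).1, (hsq i).2, Complex.mul_conj, Complex.ofReal_re]
    exact Complex.normSq_pos.2 hfN
  linarith

-- The multiplier w = -c excludes transcendence. After that, each root z of the minimal polynomial
-- is the image of c under an embedding of ℚ(c), hence is itself a multiplier.
open IntermediateField in
theorem isAlgebraic_and_re_pos {P : Set (ℝ × ℝ)} {N m : ℕ} {R : Fin m → AxisRect} (hN : 0 < N)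
    (hm : 0 < m) (hR : IsTiling P R)
    (hsq : ∀ i, (R i).right - (R i).left = 1 / N ∧ (R i).top - (R i).bottom = 1 / N)
    {c : ℝ} (hc : 0 < c) (hP : CanBeTiledByRatios P {c, 1 / c}) :
    IsAlgebraic ℚ c ∧ ∀ z : ℂ, aeval z (minpoly ℚ c) = 0 → 0 < z.re := by
  have halg : IsAlgebraic ℚ c := by
    by_contra htr
    obtain ⟨σ, hσ⟩ := exists_ringHom_adjoin_neg htr
    obtain ⟨f, hf1, hf⟩ := exists_semilinear_addMonoidHom σ hσ
    have := re_pos_of_semilinear hN hm hR hsq hc hP hf1 hf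
    rw [Complex.neg_re, Complex.ofReal_re] at this
    linarith
  refine ⟨halg, fun z hz => ?_⟩
  have hz' : z ∈ (minpoly ℚ c).aroots ℂ :=
    mem_aroots.2 ⟨minpoly.ne_zero halg.isIntegral, hz⟩
  obtain ⟨f, hf1, hf⟩ := exists_semilinear_addMonoidHom
    ((algHomAdjoinIntegralEquiv ℚ halg.isIntegral).symm ⟨z, hz'⟩).toRingHom
    (algHomAdjoinIntegralEquiv_symm_apply_gen ℚ halg.isIntegral ⟨z, hz'⟩)
  exact re_pos_of_semilinear hN hm hR hsq hc hP hf1 hf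

theorem theorem7 {n : ℕ} (v : Polygon (ℝ × ℝ) n) (P : Set (ℝ × ℝ))
    (hP : v.IsSimpleRegion P) (horth : v.IsOrthogonal) (hgen : v.IsGeneric)
    (hrat : v.HasRationalVertices) (c : ℝ) (hc : 0 < c) :
    (CanBeTiledByRatios P {c, 1 / c} ↔
      ∃ Q : AxisRect, Q.IsSquare ∧ CanBeTiledByRatios Q.toSet {c, 1 / c}) ∧
    (CanBeTiledByRatios P {c, 1 / c} →
      IsAlgebraic ℚ c ∧ ∀ z : ℂ, Polynomial.aeval z (minpoly ℚ c) = 0 → 0 < z.re) := by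
  obtain ⟨N, m, R, hN, hm, hR, hsq⟩ := Polygon.exists_square_tiling hP horth hrat
  refine ⟨⟨fun h => ?_, ?_⟩, isAlgebraic_and_re_pos hN hm hR hsq hc⟩
  · obtain ⟨halg, hre⟩ := isAlgebraic_and_re_pos hN hm hR hsq hc h
    let Q : AxisRect := ⟨0, 1, 0, 1, one_pos, one_pos⟩
    exact ⟨Q, rfl, isTileableRatio_one hc halg hre Q (by simp [Q, AxisRect.ratio])⟩
  · rintro ⟨Q, hQ, h⟩
    have hQ : Q.right - Q.left = Q.top - Q.bottom := hQ
    have hT : IsTileableRatio {c, 1 / c} 1 := by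
      have := IsTileableRatio.of_canBeTiled h
      rwa [AxisRect.ratio, hQ, div_self (sub_pos.2 Q.bottom_lt_top).ne'] at this
    refine CanBeTiledByRatios.of_subtilings R hR.cover hR.nonoverlapping fun i => hT _ ?_
    rw [AxisRect.ratio, (hsq i).1, (hsq i).2]
    exact div_self (by positivity)
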